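/- Let $E_1,E_2$ be finite dimensional real normed spaces and let $k\ge 1$ be an integer. Conventions. For a linear map $A:E\to E$ of a finite dimensional real vector space, $E^c$ (resp. $E^h$) denotes the sum of the generalised eigenspaces of $A$ for the eigenvalues on (resp. off) the imaginary axis, and $\pi^c,\pi^h=1-\pi^c$ the projections of $E=E^c\oplus E^h$. A $C^k$ vector field $F$ on $E$ with an equilibrium $p_0$ *admits a global center manifold at $p_0$* if, for the splitting of $A=DF(p_0)$, there is a $C^k$ map $\phi:E^c\to E^h$ with $\phi(\pi^cp_0)=\pi^hp_0$ and $D\phi(\pi^cp_0)=0$ whose graph $M^c=\{c+\phi(c): c\in E^c\}$ is invariant under the flow of $dp/dt=F(p)$ and consists exactly of the points $p$ whose orbit $p(t)$ exists for all $t\in\mathbb R$ and satisfies $\sup_{t\in\mathbb R}\|\pi^hp(t)\|<\infty$. Statement. For every linear map $L:E_1\times E_2\to E_1\times E_2$ there is an $\varepsilon=\varepsilon(L,k)>0$ such that the following holds. Let $F(x,y)=(f(x),g(x,y))$ be a $C^k$ feedforward vector field on $E_1\times E_2$ with an equilibrium $(x_0,y_0)$ and with $DF(x_0,y_0)=L$.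 Let $E_1\times E_2=E^c\oplus E^h$ be the splitting for $L$, let $E_1=E^{c\prime}\oplus E^{h\prime}$ be the splitting for $Df(x_0)$, and assume that $F$ admits a global center manifold $M^c$ at $(x_0,y_0)$. Assume moreover that * $dX/dt=f(X)$ admits a global center manifold at $x_0$, or * $\|DF(p)-L\|\le\varepsilon$ for all $p\in E_1\times E_2$. Then $\pi^c$ conjugates the dynamics of $F$ on $M^c$ to the dynamics of a vector field $F^c$ on $E^c$: the restriction $\pi^c|_{M^c}:M^c\to E^c$ is a bijection with a $C^k$ inverse, $M^c$ is a union of complete orbits of $F$, and a curve in $M^c$ is an integral curve of $F$ if and only if its image under $\pi^c$ is an integral curve of $F^c$. Moreover, this system on $E^c$ is again of feedforward form $$\frac{dx^c}{dt}=f^c(x^c),\qquad \frac{dy^c}{dt}=g^c(x^c,y^c)\qquad\text{for }(x^c,y^c)\in E^c ,$$ that is, $x^c\in E^{c\prime}$ for every $(x^c,y^c)\in E^c$, and there are $C^k$ maps $f^c:E^{c\prime}\to E^{c\prime}$ and $g^c:E^c\to E_2$ with $F^c(x^c,y^c)=(f^c(x^c),g^c(x^c,y^c))$ for all $(x^c,y^c)\in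 E^c$. -/

import Mathlib

open scoped TensorProduct

noncomputable section

section Splitting

variable {E : Type*} [AddCommGroup E] [Module ℝ E]

/-- The sum, in the complexification `ℂ ⊗ E`, of the generalised eigenspaces of `L` for the
eigenvalues that lie in `S`. -/
def complexSpectralSum (L : E →ₗ[ℝ] E) (S : Set ℂ) : Submodule ℂ (ℂ ⊗[ℝ] E) :=
  ⨆ μ ∈ S, Module.End.maxGenEigenspace (L.baseChange ℂ) μ

/-- The real spectral subspace of `L` for the eigenvalues in `S`: the real vectors in the sum of
the (complex) generalised eigenspaces for the eigenvalues in `S`. -/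
def spectralSubspace (L : E →ₗ[ℝ] E) (S : Set ℂ) : Submodule ℝ E where
  carrier := {v | (1 : ℂ) ⊗ₜ[ℝ] v ∈ complexSpectralSum L S}
  add_mem' := by
    intro a b ha hb
    simp only [Set.mem_ofPred_eq, TensorProduct.tmul_add] at *
    exact add_mem ha hb
  zero_mem' := by simp
  smul_mem' := by
    intro c v hv
    simp only [Set.mem_ofPred_eq, TensorProduct.tmul_smul] at *
    have h : c • ((1 : ℂ) ⊗ₜ[ℝ] v) = (c : ℂ) • ((1 : ℂ) ⊗ₜ[ℝ] v) := by
      simp [TensorProduct.smul_tmul']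
    rw [h]
    exact Submodule.smul_mem _ _ hv

/-- The center subspace of `L`: eigenvalues on the imaginary axis. -/
def centerSubspace (L : E →ₗ[ℝ] E) : Submodule ℝ E := spectralSubspace L {μ | μ.re = 0}

/-- The hyperbolic subspace of `L`: eigenvalues off the imaginary axis. -/
def hyperbolicSubspace (L : E →ₗ[ℝ] E) : Submodule ℝ E := spectralSubspace L {μ | μ.re ≠ 0}

/-- Complex conjugation on the complexification. -/
def complexificationConj : ℂ ⊗[ℝ] E →ₗ[ℝ] ℂ ⊗[ℝ] E :=
  TensorProduct.map Complex.conjLIE.toLinearEquiv.toLinearMap LinearMap.id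

/-- Real part on the complexification. -/
def complexificationRe : ℂ ⊗[ℝ] E →ₗ[ℝ] E :=
  TensorProduct.lift ((LinearMap.lsmul ℝ E).comp Complex.reLm)

theorem add_complexificationConj (z : ℂ ⊗[ℝ] E) :
    z + complexificationConj z = (2 : ℂ) • ((1 : ℂ) ⊗ₜ[ℝ] complexificationRe z) := by
  induction z with
  | zero => simp
  | add x y hx hy =>
    simp only [map_add, TensorProduct.tmul_add, smul_add, ← hx, ← hy]
    abel
  | tmul c w =>
    simp only [complexificationConj, complexificationRe, TensorProduct.map_tmul,
      TensorProduct.lift.tmul, LinearMap.comp_apply, LinearMap.id_apply]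
    simp only [LinearMap.lsmul_apply, TensorProduct.tmul_smul, ← TensorProduct.add_tmul,
      TensorProduct.smul_tmul']
    congr 1
    apply Complex.ext <;> simp [two_mul]

theorem complexificationConj_smul (c : ℂ) (z : ℂ ⊗[ℝ] E) :
    complexificationConj (c • z) = (starRingEnd ℂ c) • complexificationConj z := by
  induction z with
  | zero => simp
  | add x y hx hy => simp only [smul_add, map_add, hx, hy]
  | tmul d w => simp [complexificationConj, TensorProduct.smul_tmul']

theorem complexificationConj_baseChange (L : E →ₗ[ℝ] E) (z : ℂ ⊗[ℝ] E) :
    complexificationConj (L.baseChange ℂ z) = L.baseChange ℂ (complexificationConj z) := by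
  induction z with
  | zero => simp
  | add x y hx hy => simp only [map_add, hx, hy]
  | tmul d w => simp [complexificationConj]

theorem complexificationConj_mem_maxGenEigenspace (L : E →ₗ[ℝ] E) (μ : ℂ) (z : ℂ ⊗[ℝ] E)
    (hz : z ∈ Module.End.maxGenEigenspace (L.baseChange ℂ) μ) :
    complexificationConj z ∈ Module.End.maxGenEigenspace (L.baseChange ℂ) (starRingEnd ℂ μ) := by
  rw [Module.End.mem_maxGenEigenspace] at hz ⊢
  obtain ⟨n, hn⟩ := hz
  refine ⟨n, ?_⟩
  have key : ∀ (n : ℕ) (w : ℂ ⊗[ℝ] E),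
      ((L.baseChange ℂ - (starRingEnd ℂ μ) • (1 : Module.End ℂ (ℂ ⊗[ℝ] E))) ^ n)
        (complexificationConj w) =
      complexificationConj
        (((L.baseChange ℂ - μ • (1 : Module.End ℂ (ℂ ⊗[ℝ] E))) ^ n) w) := by
    intro n
    induction n with
    | zero => intro w; simp
    | succ n ih =>
      intro w
      rw [pow_succ, pow_succ, Module.End.mul_apply, Module.End.mul_apply, ← ih]
      congr 1
      simp [complexificationConj_smul, complexificationConj_baseChange]
  rw [key, hn, map_zero]

theorem complexificationConj_mem_complexSpectralSum (L : E →ₗ[ℝ] E) (S : Set ℂ)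
    (hS : ∀ μ ∈ S, starRingEnd ℂ μ ∈ S) (z : ℂ ⊗[ℝ] E) (hz : z ∈ complexSpectralSum L S) :
    complexificationConj z ∈ complexSpectralSum L S := by
  unfold complexSpectralSum at hz
  rw [iSup_subtype'] at hz
  induction hz using Submodule.iSup_induction' with
  | mem μ x hx =>
    have h := complexificationConj_mem_maxGenEigenspace L μ x hx
    exact (le_iSup₂_of_le (f := fun ν (_ : ν ∈ S) =>
      Module.End.maxGenEigenspace (L.baseChange ℂ) ν) _ (hS μ μ.2) le_rfl) h
  | zero => simp
  | add x y _ _ hx hy => rw [map_add]; exact add_mem hx hy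

theorem complexificationRe_mem_spectralSubspace (L : E →ₗ[ℝ] E) (S : Set ℂ)
    (hS : ∀ μ ∈ S, starRingEnd ℂ μ ∈ S) (z : ℂ ⊗[ℝ] E) (hz : z ∈ complexSpectralSum L S) :
    complexificationRe z ∈ spectralSubspace L S := by
  have h := add_mem hz (complexificationConj_mem_complexSpectralSum L S hS z hz)
  rw [add_complexificationConj] at h
  exact (Submodule.smul_mem_iff (complexSpectralSum L S) (two_ne_zero (α := ℂ))).1 h

theorem complexificationRe_one_tmul (v : E) :
    complexificationRe ((1 : ℂ) ⊗ₜ[ℝ] v) = v := by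
  simp [complexificationRe]

theorem isCompl_center_hyperbolic [FiniteDimensional ℝ E] (L : E →ₗ[ℝ] E) :
    IsCompl (centerSubspace L) (hyperbolicSubspace L) := by
  constructor
  · rw [Submodule.disjoint_def]
    intro v hc hh
    have hS : Disjoint {μ : ℂ | μ.re = 0} {μ : ℂ | μ.re ≠ 0} :=
      Set.disjoint_left.2 fun μ h h' => h' h
    have hd : Disjoint (complexSpectralSum L {μ | μ.re = 0})
        (complexSpectralSum L {μ | μ.re ≠ 0}) :=
      (Module.End.independent_maxGenEigenspace (L.baseChange ℂ)).disjoint_biSup_biSup hS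
    have h0 : (1 : ℂ) ⊗ₜ[ℝ] v = 0 := (Submodule.disjoint_def.1 hd) _ hc hh
    rw [← complexificationRe_one_tmul v, h0, map_zero]
  · rw [codisjoint_iff, eq_top_iff]
    intro v _
    have ht : complexSpectralSum L {μ | μ.re = 0} ⊔ complexSpectralSum L {μ | μ.re ≠ 0} = ⊤ := by
      rw [eq_top_iff, ← Module.End.iSup_maxGenEigenspace_eq_top (L.baseChange ℂ)]
      refine iSup_le fun μ => ?_
      by_cases hμ : μ.re = 0
      · exact le_sup_of_le_left (le_iSup₂_of_le (f := fun ν (_ : ν ∈ {μ : ℂ | μ.re = 0}) =>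
          Module.End.maxGenEigenspace (L.baseChange ℂ) ν) μ hμ le_rfl)
      · exact le_sup_of_le_right (le_iSup₂_of_le (f := fun ν (_ : ν ∈ {μ : ℂ | μ.re ≠ 0}) =>
          Module.End.maxGenEigenspace (L.baseChange ℂ) ν) μ hμ le_rfl)
    have hv : (1 : ℂ) ⊗ₜ[ℝ] v ∈
        complexSpectralSum L {μ | μ.re = 0} ⊔ complexSpectralSum L {μ | μ.re ≠ 0} := by
      rw [ht]; trivial
    obtain ⟨a, ha, b, hb, hab⟩ := Submodule.mem_sup.1 hv
    rw [← complexificationRe_one_tmul v, ← hab, map_add]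
    exact Submodule.add_mem_sup
      (complexificationRe_mem_spectralSubspace L _ (by simp) a ha)
      (complexificationRe_mem_spectralSubspace L _ (by simp) b hb)

variable [FiniteDimensional ℝ E]

/-- The projection `π^c : E → E^c` along `E^h`. -/
def centerProj (L : E →ₗ[ℝ] E) : E →ₗ[ℝ] centerSubspace L :=
  Submodule.projectionOnto _ _ (isCompl_center_hyperbolic L)

/-- The projection `π^h = 1 - π^c : E → E^h` along `E^c`. -/
def hyperbolicProj (L : E →ₗ[ℝ] E) : E →ₗ[ℝ] hyperbolicSubspace L :=
  Submodule.projectionOnto _ _ (isCompl_center_hyperbolic L).symm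

end Splitting

section CenterManifold

variable {E : Type*} [NormedAddCommGroup E] [NormedSpace ℝ E]

/-- The Jacobian of `F` at `p`, as a linear map. -/
def jacobian (F : E → E) (p : E) : E →ₗ[ℝ] E := (fderiv ℝ F p : E →ₗ[ℝ] E)

/-- The graph `{c + φ c | c ∈ E^c}` of a map `φ : E^c → E^h`. -/
def splitGraph {L : E →ₗ[ℝ] E} (φ : centerSubspace L → hyperbolicSubspace L) : Set E :=
  Set.range fun c : centerSubspace L => (c : E) + (φ c : E)

variable [FiniteDimensional ℝ E]

/-- The graph of `φ : E^c → E^h` is the (`C^k`) global center manifold of `dp/dt = F p` at the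
equilibrium `p₀`: it passes through `p₀`, is tangent to `E^c` there, is invariant under the flow,
and consists of the points whose orbit is defined for all times and has a bounded hyperbolic
part. -/
structure IsGlobalCenterManifold (k : ℕ) (F : E → E) (p₀ : E)
    (φ : centerSubspace (jacobian F p₀) → hyperbolicSubspace (jacobian F p₀)) : Prop where
  contDiff : ContDiff ℝ k φ
  map_base : φ (centerProj (jacobian F p₀) p₀) = hyperbolicProj (jacobian F p₀) p₀
  tangent : HasFDerivAt φ
    (0 : centerSubspace (jacobian F p₀) →L[ℝ] hyperbolicSubspace (jacobian F p₀))
    (centerProj (jacobian F p₀) p₀)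
  invariant : ∀ γ : ℝ → E, IsIntegralCurve γ (fun _ => F) →
    γ 0 ∈ splitGraph φ → ∀ t, γ t ∈ splitGraph φ
  eq_bounded : splitGraph φ = {p | ∃ γ : ℝ → E, IsIntegralCurve γ (fun _ => F) ∧ γ 0 = p ∧
    ∃ C : ℝ, ∀ t, ‖hyperbolicProj (jacobian F p₀) (γ t)‖ ≤ C}

/-- `dp/dt = F p` admits a (`C^k`) global center manifold at `p₀`. -/
def AdmitsGlobalCenterManifold (k : ℕ) (F : E → E) (p₀ : E) : Prop :=
  ∃ φ : centerSubspace (jacobian F p₀) → hyperbolicSubspace (jacobian F p₀),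
    IsGlobalCenterManifold k F p₀ φ

end CenterManifold

/-- `h` restricts to a `C^k` conjugacy from the dynamics of `F` on `M` to the dynamics of `V` on the
whole of `E'`: the restriction has a `C^k` inverse, `M` is filled by complete orbits of `F`, and
`h` matches the integral curves of `F` in `M` with those of `V`, over any open set of times. -/
structure ConjugatesDynamics {E E' : Type*} [NormedAddCommGroup E] [NormedSpace ℝ E]
    [NormedAddCommGroup E'] [NormedSpace ℝ E'] (k : ℕ) (h : E → E') (M : Set E)
    (F : E → E) (V : E' → E') : Prop where
  contDiff : ContDiff ℝ k h
  inverse : ∃ s : E' → E, ContDiff ℝ k s ∧ (∀ c, s c ∈ M) ∧ (∀ c, h (s c) = c) ∧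
    ∀ p ∈ M, s (h p) = p
  complete : ∀ p ∈ M, ∃ γ : ℝ → E, IsIntegralCurve γ (fun _ => F) ∧ γ 0 = p ∧ ∀ t, γ t ∈ M
  curves : ∀ (J : Set ℝ) (γ : ℝ → E), IsOpen J → (∀ t ∈ J, γ t ∈ M) →
    (IsIntegralCurveOn γ (fun _ => F) J ↔ IsIntegralCurveOn (fun t => h (γ t)) (fun _ => V) J)

/-- The feedforward vector field `(x, y) ↦ (f x, g (x, y))`. -/
def feedforward {E₁ E₂ : Type*} (f : E₁ → E₁) (g : E₁ × E₂ → E₂) : E₁ × E₂ → E₁ × E₂ :=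
  fun p => (f p.1, g p)

end

/-! The reduced field is F^c(c) = π^c F(c + φ c). Orbits in the graph of φ are recovered from their
center parts, so π^c is a conjugacy (`IsGlobalCenterManifold.conjugatesDynamics`). The real content
is the feedforward form.

The projection E₁ × E₂ → E₁ intertwines L with A = Df(x₀), hence commutes with π^c and π^h
(`map_proj`). By `exists_feedforward_form` it then suffices that the first component of φ(c) depends
only on that of c. If c and c' have equal first components, the orbits through their graph points
project to complete orbits of f with bounded hyperbolic parts and equal center parts at time 0.
These must start at the same point. If f has a global center manifold, both starting points are the
point of its graph over that center part.

Otherwise the difference z solves z' = Az + r with |r| ≤ ε|z|, and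
`exists_eq_zero_of_hyperbolicProj_bounded` gives z(0) = 0. Its proof uses two quadratic forms: W₁ is
positive on unstable directions and negative on center and stable ones, and W₂ is the same for
reversed time. Along z each satisfies W' ≥ 2bW + δ|z|² in its own time direction, and each is
bounded above because center directions contribute negatively. Boundedness forces W ≤ 0. But W₁ + W₂
vanishes on the hyperbolic vector z(0), so one form is nonnegative there; it attains its maximum 0
at time 0, where W' = 0 forces z(0) = 0. -/

open scoped TensorProduct

noncomputable section

/-! ### Functoriality of the spectral splitting -/

section Algebra

variable {E E' : Type*} [AddCommGroup E] [Module ℝ E] [AddCommGroup E'] [Module ℝ E']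

/-- After complexification `T` also intertwines the powers of L - μ and A - μ, so generalised
eigenvectors for μ go to generalised eigenvectors for the same μ. -/
theorem map_mem_complexSpectralSum (L : E →ₗ[ℝ] E) (A : E' →ₗ[ℝ] E') (T : E →ₗ[ℝ] E')
    (h : ∀ v, T (L v) = A (T v)) (S : Set ℂ) (z : ℂ ⊗[ℝ] E) (hz : z ∈ complexSpectralSum L S) :
    T.baseChange ℂ z ∈ complexSpectralSum A S := by
  have hcomm : ∀ w, T.baseChange ℂ (L.baseChange ℂ w) = A.baseChange ℂ (T.baseChange ℂ w) := by
    intro w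
    induction w with
    | zero => simp
    | add x y hx hy => simp only [map_add, hx, hy]
    | tmul c w => simp [h]
  have hpow : ∀ (μ : ℂ) (n : ℕ) (w : ℂ ⊗[ℝ] E),
      ((A.baseChange ℂ - μ • (1 : Module.End ℂ (ℂ ⊗[ℝ] E'))) ^ n) (T.baseChange ℂ w) =
        T.baseChange ℂ (((L.baseChange ℂ - μ • (1 : Module.End ℂ (ℂ ⊗[ℝ] E))) ^ n) w) := by
    intro μ n
    induction n with
    | zero => intro w; simp
    | succ n ih =>
      intro w
      rw [pow_succ, pow_succ, Module.End.mul_apply, Module.End.mul_apply, ← ih]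
      congr 1
      simp [hcomm]
  unfold complexSpectralSum at hz
  rw [iSup_subtype'] at hz
  induction hz using Submodule.iSup_induction' with
  | mem μ x hx =>
    refine (le_iSup₂_of_le (f := fun ν (_ : ν ∈ S) =>
      Module.End.maxGenEigenspace (A.baseChange ℂ) ν) _ μ.2 le_rfl) ?_
    rw [Module.End.mem_maxGenEigenspace] at hx ⊢
    obtain ⟨n, hn⟩ := hx
    exact ⟨n, by rw [hpow, hn, map_zero]⟩
  | zero => simp
  | add x y _ _ hx hy => rw [map_add]; exact add_mem hx hy

theorem map_mem_spectralSubspace (L : E →ₗ[ℝ] E) (A : E' →ₗ[ℝ] E') (T : E →ₗ[ℝ] E')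
    (h : ∀ v, T (L v) = A (T v)) (S : Set ℂ) {v : E} (hv : v ∈ spectralSubspace L S) :
    T v ∈ spectralSubspace A S := by
  have := map_mem_complexSpectralSum L A T h S _ hv
  rwa [LinearMap.baseChange_tmul] at this

variable [FiniteDimensional ℝ E] [FiniteDimensional ℝ E']

theorem centerProj_add_hyperbolicProj (L : E →ₗ[ℝ] E) (v : E) :
    (centerProj L v : E) + hyperbolicProj L v = v := by
  have := Submodule.projection_add_projection_eq_self (isCompl_center_hyperbolic L) v
  simpa [centerProj, hyperbolicProj] using this

theorem centerProj_add_coe (L : E →ₗ[ℝ] E) (c : centerSubspace L) (h : hyperbolicSubspace L) :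
    centerProj L ((c : E) + h) = c := by
  rw [map_add, centerProj, Submodule.projectionOnto_apply_left,
    Submodule.projectionOnto_apply_right, add_zero]

theorem hyperbolicProj_add_coe (L : E →ₗ[ℝ] E) (c : centerSubspace L) (h : hyperbolicSubspace L) :
    hyperbolicProj L ((c : E) + h) = h := by
  rw [map_add, hyperbolicProj, Submodule.projectionOnto_apply_left,
    Submodule.projectionOnto_apply_right, zero_add]

/-- `T` respects both summands, so it carries the decomposition of `v` to a decomposition of `T v`,
which is unique. -/
theorem map_proj (L : E →ₗ[ℝ] E) (A : E' →ₗ[ℝ] E') (T : E →ₗ[ℝ] E')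
    (h : ∀ v, T (L v) = A (T v)) (v : E) :
    T (centerProj L v) = centerProj A (T v) ∧ T (hyperbolicProj L v) = hyperbolicProj A (T v) := by
  have hc := map_mem_spectralSubspace L A T h {μ | μ.re = 0} (centerProj L v).2
  have hh := map_mem_spectralSubspace L A T h {μ | μ.re ≠ 0} (hyperbolicProj L v).2
  have e : T v = ((⟨_, hc⟩ : centerSubspace A) : E') + ((⟨_, hh⟩ : hyperbolicSubspace A) : E') := by
    rw [← map_add, centerProj_add_hyperbolicProj]
  rw [e, centerProj_add_coe, hyperbolicProj_add_coe]
  exact ⟨rfl, rfl⟩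

end Algebra

/-! ### Generalised eigenspace projections and Jordan coordinates -/

section GeneralisedEigenspaces

variable {V : Type*} [AddCommGroup V] [Module ℂ V] [FiniteDimensional ℂ V]

theorem isCompl_maxGenEigenspace (B : Module.End ℂ V) (μ : ℂ) :
    IsCompl (B.maxGenEigenspace μ) (⨆ ν ≠ μ, B.maxGenEigenspace ν) := by
  refine ⟨Module.End.independent_maxGenEigenspace B μ, ?_⟩
  rw [codisjoint_iff, eq_top_iff, ← Module.End.iSup_maxGenEigenspace_eq_top B]
  refine iSup_le fun ν => ?_
  by_cases h : ν = μ
  · exact h ▸ le_sup_left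
  · exact le_sup_of_le_right (le_iSup₂_of_le (f := fun ν (_ : ν ≠ μ) => B.maxGenEigenspace ν)
      ν h le_rfl)

/-- The projection onto a generalised eigenspace along the sum of the others. -/
def genEigenProj (B : Module.End ℂ V) (μ : ℂ) : V →ₗ[ℂ] V :=
  (B.maxGenEigenspace μ).projection _ (isCompl_maxGenEigenspace B μ)

theorem genEigenProj_of_mem (B : Module.End ℂ V) {μ : ℂ} {v : V}
    (hv : v ∈ B.maxGenEigenspace μ) : genEigenProj B μ v = v := by
  rw [genEigenProj, Submodule.projection_apply,
    Submodule.projectionOnto_apply_of_mem_left _ hv]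

theorem genEigenProj_of_mem_iSup (B : Module.End ℂ V) {μ : ℂ} {v : V}
    (hv : v ∈ ⨆ ν ≠ μ, B.maxGenEigenspace ν) : genEigenProj B μ v = 0 := by
  rw [genEigenProj, Submodule.projection_apply,
    Submodule.projectionOnto_apply_of_mem_right _ hv, Submodule.coe_zero]

theorem genEigenProj_of_mem_of_ne (B : Module.End ℂ V) {μ ν : ℂ} (h : ν ≠ μ) {v : V}
    (hv : v ∈ B.maxGenEigenspace ν) : genEigenProj B μ v = 0 :=
  genEigenProj_of_mem_iSup B
    ((le_iSup₂_of_le (f := fun ν (_ : ν ≠ μ) => B.maxGenEigenspace ν) ν h le_rfl) hv)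

theorem induction_maxGenEigenspace (B : Module.End ℂ V) {p : V → Prop}
    (mem : ∀ μ, ∀ v ∈ B.maxGenEigenspace μ, p v) (zero : p 0)
    (add : ∀ v w, p v → p w → p (v + w)) (v : V) : p v := by
  have hv : v ∈ ⨆ μ, B.maxGenEigenspace μ := by
    rw [Module.End.iSup_maxGenEigenspace_eq_top]; trivial
  exact Submodule.iSup_induction _ (motive := p) hv mem zero add

theorem genEigenProj_mem (B : Module.End ℂ V) (μ : ℂ) (v : V) :
    genEigenProj B μ v ∈ B.maxGenEigenspace μ := by
  rw [genEigenProj, Submodule.projection_apply]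
  exact Subtype.property _

theorem genEigenProj_comm (B : Module.End ℂ V) (μ : ℂ) (v : V) :
    genEigenProj B μ (B v) = B (genEigenProj B μ v) := by
  induction v using induction_maxGenEigenspace B with
  | mem ν v hv =>
    have hB := Module.End.mapsTo_maxGenEigenspace_of_comm (Commute.refl B) ν hv
    by_cases h : ν = μ
    · subst h
      rw [genEigenProj_of_mem B hv, genEigenProj_of_mem B hB]
    · rw [genEigenProj_of_mem_of_ne B h hv, genEigenProj_of_mem_of_ne B h hB, map_zero]
  | zero => simp
  | add v w hv hw => simp only [map_add, hv, hw]

/-- The projections over the finitely many eigenvalues sum to the identity. -/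
theorem exists_finset_genEigenProj (B : Module.End ℂ V) :
    ∃ s : Finset ℂ, ∀ v, (∀ μ ∈ s, genEigenProj B μ v = 0) → v = 0 := by
  refine ⟨B.finite_hasEigenvalue.toFinset, fun v h => ?_⟩
  have hsum : ∑ μ ∈ B.finite_hasEigenvalue.toFinset, genEigenProj B μ v = v := by
    clear h
    induction v using induction_maxGenEigenspace B with
    | mem ν v hv =>
      rw [Finset.sum_eq_single ν, genEigenProj_of_mem B hv]
      · exact fun μ _ hμ => genEigenProj_of_mem_of_ne B hμ.symm hv
      · intro hν
        rw [genEigenProj_of_mem B hv]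
        by_contra hv0
        apply hν
        rw [Set.Finite.mem_toFinset]
        rw [Module.End.maxGenEigenspace_eq_genEigenspace_finrank] at hv
        apply Module.End.hasEigenvalue_of_hasGenEigenvalue (k := Module.finrank ℂ V)
        intro hbot
        rw [hbot] at hv
        exact hv0 hv
    | zero => simp
    | add v w hv hw => simp only [map_add, Finset.sum_add_distrib, hv, hw]
  rw [← hsum]
  exact Finset.sum_eq_zero h

end GeneralisedEigenspaces

/-- Coordinates adapted to the generalised eigenspaces of the complexification of `A`: on the block
of `μ`, the `j`-th coordinate is `(A - μ) ^ j` applied to the component in that block. -/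
theorem exists_jordan_chains {E : Type*} [AddCommGroup E] [Module ℝ E] [FiniteDimensional ℝ E]
    (A : E →ₗ[ℝ] E) :
    ∃ (s : Finset ℂ) (n d : ℕ) (T : ℂ → ℕ → E →ₗ[ℝ] EuclideanSpace ℂ (Fin d)),
      (∀ μ j z, T μ j (A z) = μ • T μ j z + T μ (j + 1) z) ∧
      (∀ μ z, T μ n z = 0) ∧
      (∀ z, (∀ μ ∈ s, T μ 0 z = 0) → z = 0) ∧
      (∀ S : Set ℂ, ∀ z ∈ spectralSubspace A S, ∀ μ ∉ S, ∀ j, T μ j z = 0) := by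
  set B : Module.End ℂ (ℂ ⊗[ℝ] E) := A.baseChange ℂ with hB
  obtain ⟨s, hs⟩ := exists_finset_genEigenProj B
  have e : (ℂ ⊗[ℝ] E) ≃ₗ[ℂ] EuclideanSpace ℂ (Fin (Module.finrank ℂ (ℂ ⊗[ℝ] E))) :=
    LinearEquiv.ofFinrankEq _ _ (by simp)
  -- No Jordan basis is chosen: applying powers of B - μ to the whole component already gives the
  -- chain relation, and the dimension bounds the nilpotency index.
  refine ⟨s, Module.finrank ℂ (ℂ ⊗[ℝ] E), _, fun μ j =>
    ((e.toLinearMap ∘ₗ ((B - μ • (1 : Module.End ℂ (ℂ ⊗[ℝ] E))) ^ j) ∘ₗ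
      genEigenProj B μ).restrictScalars ℝ) ∘ₗ TensorProduct.mk ℝ ℂ E 1, ?_, ?_, ?_, ?_⟩
  · intro μ j z
    have h1 : (1 : ℂ) ⊗ₜ[ℝ] A z = B ((1 : ℂ) ⊗ₜ[ℝ] z) := by simp [hB]
    have h2 : ∀ w, B w = μ • w + (B - μ • (1 : Module.End ℂ (ℂ ⊗[ℝ] E))) w := by
      intro w; simp
    simp only [LinearMap.comp_apply, LinearMap.restrictScalars_apply, TensorProduct.mk_apply,
      LinearEquiv.coe_coe, h1, genEigenProj_comm]
    rw [h2 (genEigenProj B μ _), map_add, map_add, map_smul, map_smul, pow_succ,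
      Module.End.mul_apply]
  · intro μ z
    have h := genEigenProj_mem B μ ((1 : ℂ) ⊗ₜ[ℝ] z)
    rw [Module.End.maxGenEigenspace_eq_genEigenspace_finrank, Module.End.mem_genEigenspace_nat,
      LinearMap.mem_ker] at h
    simp only [LinearMap.comp_apply, LinearMap.restrictScalars_apply, TensorProduct.mk_apply, h,
      map_zero]
  · intro z hz
    have h0 : (1 : ℂ) ⊗ₜ[ℝ] z = 0 := by
      refine hs _ fun μ hμ => ?_
      have := hz μ hμ
      simpa using this
    rw [← complexificationRe_one_tmul z, h0, map_zero]
  · intro S z hz μ hμ j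
    have h0 : genEigenProj B μ ((1 : ℂ) ⊗ₜ[ℝ] z) = 0 := by
      refine genEigenProj_of_mem_iSup B ?_
      refine (iSup₂_le fun ν hν => ?_ : complexSpectralSum A S ≤ _) hz
      exact le_iSup₂_of_le (f := fun ν (_ : ν ≠ μ) => B.maxGenEigenspace ν) ν
        (fun h => hμ (h ▸ hν)) le_rfl
    simp [h0]

/-! ### Growth of quadratic forms along orbits -/

/-- A function that grows at least exponentially where it is positive and is bounded above cannot
be positive. -/
theorem nonpos_of_mul_le_deriv {w w' : ℝ → ℝ} {c C : ℝ} (hc : 0 < c)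
    (hw : ∀ t, HasDerivAt w (w' t) t) (hle : ∀ t, c * w t ≤ w' t) (hC : ∀ t, w t ≤ C) (t : ℝ) :
    w t ≤ 0 := by
  have hd : ∀ t, HasDerivAt (fun t => Real.exp (-c * t) * w t)
      (Real.exp (-c * t) * (-c * 1) * w t + Real.exp (-c * t) * w' t) t := fun t =>
    ((((hasDerivAt_id t).const_mul (-c)).exp).mul (hw t))
  -- With the integrating factor the function is nondecreasing, while the upper bound `C` is damped
  -- to 0.
  have hmono : Monotone fun t => Real.exp (-c * t) * w t := by
    refine monotone_of_deriv_nonneg (fun t => (hd t).differentiableAt) fun t => ?_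
    rw [(hd t).deriv]
    have := mul_nonneg (Real.exp_pos (-c * t)).le (sub_nonneg.2 (hle t))
    linarith
  have hlim : Filter.Tendsto (fun u : ℝ => Real.exp (-c * u) * C) Filter.atTop (nhds 0) := by
    have h1 : Filter.Tendsto (fun u : ℝ => -c * u) Filter.atTop Filter.atBot :=
      Filter.tendsto_id.const_mul_atTop_of_neg (neg_lt_zero.2 hc)
    simpa using (Real.tendsto_exp_atBot.comp h1).mul_const C
  have hle0 : Real.exp (-c * t) * w t ≤ 0 := by
    refine ge_of_tendsto hlim ?_
    filter_upwards [Filter.eventually_ge_atTop t] with u hu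
    exact (hmono hu).trans (mul_le_mul_of_nonneg_left (hC u) (Real.exp_pos _).le)
  exact nonpos_of_mul_nonpos_right hle0 (Real.exp_pos _)

section

variable {E : Type*} [NormedAddCommGroup E] [NormedSpace ℝ E]

/-- A Lyapunov form that is bounded above along a complete orbit of a perturbed linear equation
and nonnegative at its initial point forces that point to vanish. -/
theorem eq_zero_of_lyapunov {A : E →L[ℝ] E} {W : E →L[ℝ] E →L[ℝ] ℝ} (hsymm : ∀ u v, W u v = W v u)
    {b δ ε C : ℝ} (hb : 0 < b) (hδ : 0 < δ) (hlyap : ∀ v, b * W v v + δ * ‖v‖ ^ 2 ≤ W v (A v))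
    (hε : ‖W‖ * ε ≤ δ / 2) {z z' : ℝ → E} (hz : ∀ t, HasDerivAt z (z' t) t)
    (hpert : ∀ t, ‖z' t - A (z t)‖ ≤ ε * ‖z t‖) (hC : ∀ t, W (z t) (z t) ≤ C)
    (h0 : 0 ≤ W (z 0) (z 0)) : z 0 = 0 := by
  have hd : ∀ t, HasDerivAt (fun t => W (z t) (z t)) (2 * W (z t) (z' t)) t := fun t => by
    have h := (W.hasFDerivAt.comp_hasDerivAt t (hz t)).clm_apply (hz t)
    rw [hsymm (z' t) (z t)] at h
    rw [two_mul]
    exact h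
  have hgrow : ∀ t, 2 * b * W (z t) (z t) + δ * ‖z t‖ ^ 2 ≤ 2 * W (z t) (z' t) := by
    intro t
    have h1 : W (z t) (z' t) = W (z t) (A (z t)) + W (z t) (z' t - A (z t)) := by
      rw [← map_add]; congr 1; abel
    have h2 : ‖W (z t) (z' t - A (z t))‖ ≤ ‖W‖ * ‖z t‖ * (ε * ‖z t‖) :=
      (W.le_opNorm₂ _ _).trans (mul_le_mul_of_nonneg_left (hpert t) (by positivity))
    have h3 := (abs_le.1 h2).1
    have h4 := hlyap (z t)
    have h5 := mul_le_mul_of_nonneg_right hε (sq_nonneg ‖z t‖)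
    rw [h1]
    nlinarith
  have hnonpos := nonpos_of_mul_le_deriv (w := fun t => W (z t) (z t)) (mul_pos two_pos hb) hd
    (fun t => by have := hgrow t; have := mul_nonneg hδ.le (sq_nonneg ‖z t‖); linarith) hC
  -- The form is nonpositive throughout and nonnegative at time 0, so it has a maximum there and its
  -- derivative vanishes.
  have hmax : IsLocalMax (fun t => W (z t) (z t)) 0 :=
    Filter.Eventually.of_forall fun t => (hnonpos t).trans h0
  have hder := hmax.hasDerivAt_eq_zero (hd 0)
  have h6 := hgrow 0
  rw [hder] at h6
  have h7 : ‖z 0‖ ^ 2 ≤ 0 := by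
    have : 0 ≤ 2 * b * W (z 0) (z 0) := by positivity
    by_contra h
    have := mul_pos hδ (not_le.1 h)
    linarith
  have h8 : ‖z 0‖ ^ 2 = 0 := le_antisymm h7 (sq_nonneg _)
  simpa using h8

end

/-- The weights rescale the Jordan chain so that its nilpotent part has size of order `l⁻¹`. Only
the terms pairing `x j` with `x (j + 1)` deviate from multiplication by the real part of μ, and a
weighted AM-GM inequality bounds them. -/
theorem abs_jordan_block_sub_le {H : Type*} [NormedAddCommGroup H] [InnerProductSpace ℂ H]
    {x y : ℕ → H} {μ : ℂ} {n : ℕ} (hy : ∀ j, y j = μ • x j + x (j + 1)) (hn : x n = 0)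
    {l : ℝ} (hl : 0 < l) :
    |∑ j ∈ Finset.range n, l ^ (2 * j) * (inner ℂ (x j) (y j)).re -
        μ.re * ∑ j ∈ Finset.range n, l ^ (2 * j) * ‖x j‖ ^ 2| ≤
      l⁻¹ * ∑ j ∈ Finset.range n, l ^ (2 * j) * ‖x j‖ ^ 2 := by
  have hshift : ∑ j ∈ Finset.range n, l ^ (2 * (j + 1)) * ‖x (j + 1)‖ ^ 2 ≤
      ∑ j ∈ Finset.range n, l ^ (2 * j) * ‖x j‖ ^ 2 := by
    have h1 := Finset.sum_range_succ' (fun j => l ^ (2 * j) * ‖x j‖ ^ 2) n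
    have h2 := Finset.sum_range_succ (fun j => l ^ (2 * j) * ‖x j‖ ^ 2) n
    simp only [hn, norm_zero] at h2
    have h3 : 0 ≤ l ^ (2 * 0) * ‖x 0‖ ^ 2 := by positivity
    linarith
  have hterm : ∀ j, l ^ (2 * j) * (inner ℂ (x j) (y j)).re - μ.re * (l ^ (2 * j) * ‖x j‖ ^ 2) =
      l ^ (2 * j) * (inner ℂ (x j) (x (j + 1))).re := by
    intro j
    rw [hy, inner_add_right, inner_smul_right, inner_self_eq_norm_sq_to_K, Complex.add_re]
    have : (μ * ((‖x j‖ : ℂ)) ^ 2).re = μ.re * ‖x j‖ ^ 2 := by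
      rw [← Complex.ofReal_pow, Complex.re_mul_ofReal]
    erw [this]
    ring
  have hbound : ∀ j, |l ^ (2 * j) * (inner ℂ (x j) (x (j + 1))).re| ≤
      l⁻¹ * ((l ^ (2 * j) * ‖x j‖ ^ 2 + l ^ (2 * (j + 1)) * ‖x (j + 1)‖ ^ 2) / 2) := by
    intro j
    have h1 : |(inner ℂ (x j) (x (j + 1))).re| ≤ ‖x j‖ * ‖x (j + 1)‖ :=
      (Complex.abs_re_le_norm _).trans (norm_inner_le_norm _ _)
    have h2 : ‖x j‖ * ‖x (j + 1)‖ ≤ l⁻¹ * ((‖x j‖ ^ 2 + l ^ 2 * ‖x (j + 1)‖ ^ 2) / 2) := by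
      rw [le_inv_mul_iff₀ hl]
      nlinarith [sq_nonneg (‖x j‖ - l * ‖x (j + 1)‖)]
    rw [abs_mul, abs_of_pos (by positivity : 0 < l ^ (2 * j))]
    calc l ^ (2 * j) * |(inner ℂ (x j) (x (j + 1))).re|
        ≤ l ^ (2 * j) * (l⁻¹ * ((‖x j‖ ^ 2 + l ^ 2 * ‖x (j + 1)‖ ^ 2) / 2)) := by
          gcongr; exact h1.trans h2
      _ = _ := by rw [mul_add 2 j 1, pow_add]; ring
  rw [Finset.mul_sum, ← Finset.sum_sub_distrib, Finset.sum_congr rfl fun j _ => hterm j]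
  refine (Finset.abs_sum_le_sum_abs _ _).trans ((Finset.sum_le_sum fun j _ => hbound j).trans ?_)
  rw [← Finset.mul_sum, ← Finset.sum_div, Finset.sum_add_distrib]
  have := inv_pos.2 hl
  gcongr
  linarith

/-! ### Lyapunov forms and uniqueness of hyperbolically bounded orbits -/

section LyapunovForms

variable {E : Type*} [NormedAddCommGroup E] [NormedSpace ℝ E] [FiniteDimensional ℝ E]

theorem exists_pos_le_abs_re (s : Finset ℂ) : ∃ m : ℝ, 0 < m ∧ ∀ μ ∈ s, μ.re ≠ 0 → m ≤ |μ.re| := by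
  induction s using Finset.induction_on with
  | empty => exact ⟨1, one_pos, by simp⟩
  | insert a s _ ih =>
    obtain ⟨m, hm, h⟩ := ih
    by_cases ha : a.re = 0
    · refine ⟨m, hm, fun μ hμ h0 => ?_⟩
      rcases Finset.mem_insert.1 hμ with rfl | hμ
      · exact absurd ha h0
      · exact h μ hμ h0
    · refine ⟨min m |a.re|, lt_min hm (abs_pos.2 ha), fun μ hμ h0 => ?_⟩
      rcases Finset.mem_insert.1 hμ with rfl | hμ
      · exact min_le_right _ _
      · exact (min_le_left _ _).trans (h μ hμ h0)

/-- Lyapunov forms for `A` and for `-A`: the form `W₁` is positive on the unstable subspace and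
negative on the center-stable one, and `W₂` is its analogue for the reversed time. -/
theorem exists_lyapunov_forms (A : E →L[ℝ] E) :
    ∃ (W₁ W₂ : E →L[ℝ] E →L[ℝ] ℝ) (b δ : ℝ), 0 < b ∧ 0 < δ ∧
      (∀ u v, W₁ u v = W₁ v u) ∧ (∀ u v, W₂ u v = W₂ v u) ∧
      (∀ v, b * W₁ v v + δ * ‖v‖ ^ 2 ≤ W₁ v (A v)) ∧
      (∀ v, b * W₂ v v + δ * ‖v‖ ^ 2 ≤ W₂ v (-A v)) ∧
      (∀ v, W₁ v v ≤ W₁ (hyperbolicProj (A : E →ₗ[ℝ] E) v) (hyperbolicProj (A : E →ₗ[ℝ] E) v)) ∧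
      (∀ v, W₂ v v ≤ W₂ (hyperbolicProj (A : E →ₗ[ℝ] E) v) (hyperbolicProj (A : E →ₗ[ℝ] E) v)) ∧
      (∀ v ∈ hyperbolicSubspace (A : E →ₗ[ℝ] E), W₁ v v + W₂ v v = 0) := by
  obtain ⟨s, n, d, T, hchain, hn, hinj, hspec⟩ := exists_jordan_chains (A : E →ₗ[ℝ] E)
  obtain ⟨m, hm, hms⟩ := exists_pos_le_abs_re s
  -- Here `m` is a lower bound for the nonzero |Re μ|. This choice makes the nilpotent error m/8,
  -- leaving room for the rate b = m/4 and a further m/8 of coercivity.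
  set l : ℝ := 8 / m with hldef
  have hl : 0 < l := by positivity
  let q : ℂ → E → ℝ := fun μ v => ∑ j ∈ Finset.range n, l ^ (2 * j) * ‖T μ j v‖ ^ 2
  have hq0 : ∀ μ v, 0 ≤ q μ v := fun μ v => Finset.sum_nonneg fun j _ => by positivity
  let W : (ℂ → ℝ) → E →L[ℝ] E →L[ℝ] ℝ := fun σ => ∑ μ ∈ s, σ μ • ∑ j ∈ Finset.range n,
    l ^ (2 * j) • (innerSL ℝ (E := EuclideanSpace ℂ (Fin d))).bilinearComp
      (T μ j).toContinuousLinearMap (T μ j).toContinuousLinearMap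
  have hW : ∀ σ u v, W σ u v = ∑ μ ∈ s, σ μ * ∑ j ∈ Finset.range n,
      l ^ (2 * j) * (inner ℂ (T μ j u) (T μ j v)).re := by
    intro σ u v
    simp only [W, sum_apply, smul_apply,
      ContinuousLinearMap.bilinearComp_apply, smul_eq_mul, innerSL_apply_apply,
      LinearMap.coe_toContinuousLinearMap', PiLp.inner_apply, Complex.re_sum,
      real_inner_eq_re_inner ℂ, RCLike.re_eq_complex_re]
  have hWq : ∀ σ v, W σ v v = ∑ μ ∈ s, σ μ * q μ v := by
    intro σ v
    rw [hW]
    refine Finset.sum_congr rfl fun μ _ => ?_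
    congr 1
    refine Finset.sum_congr rfl fun j _ => ?_
    congr 1
    exact (norm_sq_eq_re_inner (𝕜 := ℂ) (T μ j v)).symm
  have hsymm : ∀ σ u v, W σ u v = W σ v u := by
    intro σ u v
    simp only [hW]
    refine Finset.sum_congr rfl fun μ _ => ?_
    congr 1
    refine Finset.sum_congr rfl fun j _ => ?_
    congr 1
    exact inner_re_symm (𝕜 := ℂ) _ _
  obtain ⟨δ, hδ, hcoer⟩ : ∃ δ > 0, ∀ v : E, δ * ‖v‖ ^ 2 ≤ ∑ μ ∈ s, q μ v := by
    -- The leading coordinates `T μ 0` are jointly injective, and an injective linear map in finite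
    -- dimension is bounded below.
    let f : E →ₗ[ℝ] (s → EuclideanSpace ℂ (Fin d)) := LinearMap.pi fun μ => T μ 0
    have hker : LinearMap.ker f = ⊥ := by
      rw [LinearMap.ker_eq_bot']
      intro v hv
      exact hinj v fun μ hμ => congrFun hv ⟨μ, hμ⟩
    obtain ⟨K, hK, hanti⟩ := f.exists_antilipschitzWith hker
    have hKpos : (0 : ℝ) < K := hK
    refine ⟨(K ^ 2 : ℝ)⁻¹, by positivity, fun v => ?_⟩
    have h1 : ‖v‖ ≤ K * ‖f v‖ := by
      simpa using hanti.le_mul_dist v 0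
    have hT0 : ∀ μ, ‖T μ 0 v‖ ^ 2 ≤ q μ v := by
      intro μ
      rcases Nat.eq_zero_or_pos n with h | h
      · have := hn μ v
        rw [h] at this
        rw [this]
        simpa using hq0 μ v
      · have := Finset.single_le_sum (f := fun j => l ^ (2 * j) * ‖T μ j v‖ ^ 2)
          (fun j _ => by positivity) (Finset.mem_range.2 h)
        simpa using this
    have h2 : ‖f v‖ ≤ √(∑ μ ∈ s, q μ v) := by
      rw [pi_norm_le_iff_of_nonneg (Real.sqrt_nonneg _)]
      intro μ
      refine Real.le_sqrt_of_sq_le ((hT0 μ).trans ?_)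
      exact Finset.single_le_sum (f := fun μ => q μ v) (fun μ _ => hq0 μ v) μ.2
    have h3 : ‖v‖ ^ 2 ≤ K ^ 2 * ∑ μ ∈ s, q μ v := by
      calc ‖v‖ ^ 2 ≤ (K * √(∑ μ ∈ s, q μ v)) ^ 2 := by gcongr; exact h1.trans (by gcongr)
        _ = _ := by rw [mul_pow, Real.sq_sqrt (Finset.sum_nonneg fun μ _ => hq0 μ v)]
    rwa [inv_mul_le_iff₀ (by positivity)]
  -- `τ = 1` and `τ = -1` stand for forward and reversed time. Center blocks get the sign -1 in
  -- both: there b * W is negative enough to absorb the nilpotent error.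
  let σ : ℝ → ℂ → ℝ := fun τ μ => if 0 < τ * μ.re then 1 else -1
  have hlyap : ∀ τ : ℝ, (τ = 1 ∨ τ = -1) → ∀ v,
      m / 4 * W (σ τ) v v + m / 8 * δ * ‖v‖ ^ 2 ≤ τ * W (σ τ) v (A v) := by
    intro τ hτ v
    have hblock : ∀ μ ∈ s, m / 4 * (σ τ μ * q μ v) + m / 8 * q μ v ≤ τ * (σ τ μ *
        ∑ j ∈ Finset.range n, l ^ (2 * j) * (inner ℂ (T μ j v) (T μ j (A v))).re) := by
      intro μ hμ
      have h1 := abs_jordan_block_sub_le (x := fun j => T μ j v) (y := fun j => T μ j (A v))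
        (n := n) (fun j => hchain μ j v) (hn μ v) hl
      have h2 : l⁻¹ = m / 8 := by rw [hldef, inv_div]
      rw [h2] at h1
      change |_ - μ.re * q μ v| ≤ m / 8 * q μ v at h1
      obtain ⟨h3, h4⟩ := abs_le.1 h1
      have h5 := hq0 μ v
      generalize ∑ j ∈ Finset.range n, l ^ (2 * j) * (inner ℂ (T μ j v) (T μ j (A v))).re = I
        at h3 h4 ⊢
      generalize q μ v = Q at h3 h4 h5 ⊢
      simp only [σ]
      have h6 := mul_nonneg hm.le h5
      split_ifs with hpos
      · have hre : μ.re ≠ 0 := by rintro h; simp [h] at hpos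
        have h7 := mul_le_mul_of_nonneg_right (hms μ hμ hre) h5
        rcases hτ with rfl | rfl
        · rw [abs_of_pos (by linarith)] at h7
          linarith
        · rw [abs_of_neg (by linarith)] at h7
          linarith
      · have h7 := mul_nonneg (neg_nonneg.2 (not_lt.1 hpos)) h5
        rcases hτ with rfl | rfl <;> linarith
    have h1 := Finset.sum_le_sum hblock
    rw [Finset.sum_add_distrib, ← Finset.mul_sum, ← Finset.mul_sum, ← Finset.mul_sum, ← hWq,
      ← hW] at h1
    have h2 := mul_le_mul_of_nonneg_left (hcoer v) (by positivity : 0 ≤ m / 8)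
    linarith
  have hhyp : ∀ μ : ℂ, μ.re = 0 → ∀ v ∈ hyperbolicSubspace (A : E →ₗ[ℝ] E), q μ v = 0 := by
    intro μ hμ v hv
    refine Finset.sum_eq_zero fun j _ => ?_
    rw [hspec _ v hv μ (by simpa using hμ) j]
    simp
  have hupper : ∀ τ v, W (σ τ) v v ≤
      W (σ τ) (hyperbolicProj (A : E →ₗ[ℝ] E) v) (hyperbolicProj (A : E →ₗ[ℝ] E) v) := by
    intro τ v
    rw [hWq, hWq]
    refine Finset.sum_le_sum fun μ _ => ?_
    -- Center blocks enter with a minus sign, so dropping them can only increase the form; the other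
    -- blocks do not see the center part of `v`.
    by_cases hμ : μ.re = 0
    · rw [hhyp μ hμ _ (hyperbolicProj (A : E →ₗ[ℝ] E) v).2]
      have := hq0 μ v
      simp [σ, hμ, this]
    · refine le_of_eq ?_
      congr 1
      refine Finset.sum_congr rfl fun j _ => ?_
      conv_lhs => rw [← centerProj_add_hyperbolicProj (A : E →ₗ[ℝ] E) v, map_add,
        hspec _ _ (centerProj (A : E →ₗ[ℝ] E) v).2 μ hμ j, zero_add]
  refine ⟨W (σ 1), W (σ (-1)), m / 4, m / 8 * δ, by positivity, by positivity, hsymm _, hsymm _,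
    fun v => ?_, fun v => ?_, hupper 1, hupper (-1), fun v hv => ?_⟩
  · simpa using hlyap 1 (Or.inl rfl) v
  · simpa using hlyap (-1) (Or.inr rfl) v
  · rw [hWq, hWq, ← Finset.sum_add_distrib]
    refine Finset.sum_eq_zero fun μ _ => ?_
    by_cases hμ : μ.re = 0
    · rw [hhyp μ hμ v hv]; simp
    · rcases lt_or_gt_of_ne hμ with h | h
      · simp [σ, h, h.not_gt]
      · simp [σ, h, h.not_gt]

/-- Complete orbits of a small perturbation of a linear equation that start with a vanishing center
part and keep their hyperbolic part bounded are trivial. -/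
theorem exists_eq_zero_of_hyperbolicProj_bounded (A : E →L[ℝ] E) :
    ∃ ε > 0, ∀ z z' : ℝ → E, (∀ t, HasDerivAt z (z' t) t) →
      (∀ t, ‖z' t - A (z t)‖ ≤ ε * ‖z t‖) → centerProj (A : E →ₗ[ℝ] E) (z 0) = 0 →
      (∃ C, ∀ t, ‖hyperbolicProj (A : E →ₗ[ℝ] E) (z t)‖ ≤ C) → z 0 = 0 := by
  obtain ⟨W₁, W₂, b, δ, hb, hδ, hs₁, hs₂, hl₁, hl₂, hu₁, hu₂, hsum⟩ := exists_lyapunov_forms A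
  have hW₁ : 0 ≤ ‖W₁‖ := norm_nonneg W₁
  have hW₂ : 0 ≤ ‖W₂‖ := norm_nonneg W₂
  have hε : ∀ a : ℝ, 0 ≤ a → a ≤ ‖W₁‖ + ‖W₂‖ → a * (δ / 2 / (‖W₁‖ + ‖W₂‖ + 1)) ≤ δ / 2 := by
    intro a ha hle
    rw [mul_div_assoc', div_le_iff₀ (by positivity), mul_comm]
    exact mul_le_mul_of_nonneg_left (by linarith) (by positivity)
  -- The `+ 1` keeps the denominator positive, and ε times either norm is at most δ / 2.
  refine ⟨δ / 2 / (‖W₁‖ + ‖W₂‖ + 1), by positivity, fun z z' hz hpert hc ⟨C, hC⟩ => ?_⟩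
  have hbdd : ∀ W : E →L[ℝ] E →L[ℝ] ℝ, (∀ v, W v v ≤ W (hyperbolicProj (A : E →ₗ[ℝ] E) v)
      (hyperbolicProj (A : E →ₗ[ℝ] E) v)) → ∀ t, W (z t) (z t) ≤ ‖W‖ * C * C := by
    intro W hW t
    refine (hW _).trans ((le_abs_self _).trans ((W.le_opNorm₂ _ _).trans ?_))
    have h := hC t
    have h0 : 0 ≤ C := (norm_nonneg _).trans h
    gcongr <;> exact h
  have hmem : z 0 ∈ hyperbolicSubspace (A : E →ₗ[ℝ] E) := by
    have := centerProj_add_hyperbolicProj (A : E →ₗ[ℝ] E) (z 0)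
    rw [hc, Submodule.coe_zero, zero_add] at this
    rw [← this]
    exact Subtype.property _
  have h0 := hsum _ hmem
  -- The two values are opposite, so one is nonnegative; for `W₂` the argument runs along the
  -- time-reversed curve, a perturbed orbit of `-A`.
  rcases le_total 0 (W₁ (z 0) (z 0)) with h | h
  · exact eq_zero_of_lyapunov hs₁ hb hδ hl₁ (hε _ hW₁ (by linarith)) hz hpert
      (hbdd W₁ hu₁) h
  · have key := eq_zero_of_lyapunov (A := -A) (z := fun t => z (-t)) (z' := fun t => -z' (-t)) hs₂
      hb hδ (fun v => by simpa using hl₂ v) (hε _ hW₂ (by linarith))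
      (fun t => by simpa [Function.comp_def] using (hz (-t)).scomp t (hasDerivAt_neg t))
      (fun t => by
        have h1 : -z' (-t) - (-A) (z (-t)) = -(z' (-t) - A (z (-t))) := by
          rw [neg_apply]; abel
        rw [h1, norm_neg]
        exact hpert (-t))
      (fun t => hbdd W₂ hu₂ (-t)) (by simp only [neg_zero]; linarith)
    simpa using key

end LyapunovForms

/-! ### The reduced vector field on the center subspace -/

section Conjugacy

variable {E : Type*} [NormedAddCommGroup E] [NormedSpace ℝ E] [FiniteDimensional ℝ E]

theorem contDiff_of_linearMap {G : Type*} [NormedAddCommGroup G] [NormedSpace ℝ G] {n : WithTop ℕ∞}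
    (T : E →ₗ[ℝ] G) : ContDiff ℝ n T :=
  (LinearMap.toContinuousLinearMap T).contDiff

variable {k : ℕ} {F : E → E} {p₀ : E}
  {φ : centerSubspace (jacobian F p₀) → hyperbolicSubspace (jacobian F p₀)}

theorem contDiff_graphMap (h : IsGlobalCenterManifold k F p₀ φ) :
    ContDiff ℝ k fun c : centerSubspace (jacobian F p₀) => (c : E) + (φ c : E) :=
  (contDiff_of_linearMap (Submodule.subtype _)).add
    ((contDiff_of_linearMap (Submodule.subtype _)).comp h.contDiff)

theorem graphMap_centerProj {p : E} (hp : p ∈ splitGraph φ) :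
    (centerProj (jacobian F p₀) p : E) + (φ (centerProj (jacobian F p₀) p) : E) = p := by
  obtain ⟨c, rfl⟩ := hp
  simp only [centerProj_add_coe]

theorem IsGlobalCenterManifold.exists_orbit (h : IsGlobalCenterManifold k F p₀ φ) {p : E}
    (hp : p ∈ splitGraph φ) : ∃ γ : ℝ → E, IsIntegralCurve γ (fun _ => F) ∧ γ 0 = p ∧
      ∃ C : ℝ, ∀ t, ‖hyperbolicProj (jacobian F p₀) (γ t)‖ ≤ C := by
  rw [h.eq_bounded] at hp
  exact hp

/-- A vector field is tangent to its global center manifold. -/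
theorem IsGlobalCenterManifold.fderiv_graphMap (h : IsGlobalCenterManifold k F p₀ φ) (hk : 1 ≤ k)
    (c : centerSubspace (jacobian F p₀)) :
    fderiv ℝ (fun c : centerSubspace (jacobian F p₀) => (c : E) + (φ c : E)) c
      (centerProj (jacobian F p₀) (F (c + φ c))) = F (c + φ c) := by
  obtain ⟨γ, hγ, hγ0, -⟩ := h.exists_orbit (p := (c : E) + φ c) ⟨c, rfl⟩
  have hmem := h.invariant γ hγ (hγ0 ▸ ⟨c, rfl⟩)
  have hs := ((contDiff_graphMap h).differentiable (by exact_mod_cast Nat.one_le_iff_ne_zero.1 hk) c).hasFDerivAt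
  have hγd := hγ 0
  simp only [hγ0] at hγd
  have hcd : HasDerivAt (fun t => centerProj (jacobian F p₀) (γ t))
      (centerProj (jacobian F p₀) (F (c + φ c))) 0 :=
    (LinearMap.toContinuousLinearMap (centerProj (jacobian F p₀))).hasFDerivAt.comp_hasDerivAt 0 hγd
  have hc0 : centerProj (jacobian F p₀) (γ 0) = c := by rw [hγ0, centerProj_add_coe]
  have hcomp := (hc0.symm ▸ hs).comp_hasDerivAt 0 hcd
  -- The orbit stays in the graph, so it is the graph map applied to its center part;
  -- differentiating at time 0 gives tangency.
  have heq : (fun c : centerSubspace (jacobian F p₀) => (c : E) + (φ c : E)) ∘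
      (fun t => centerProj (jacobian F p₀) (γ t)) = γ :=
    funext fun t => graphMap_centerProj (hmem t)
  rw [heq] at hcomp
  rw [hc0] at hcomp
  exact hcomp.unique hγd

/-- The vector field induced on the center subspace. -/
theorem IsGlobalCenterManifold.conjugatesDynamics (h : IsGlobalCenterManifold k F p₀ φ)
    (hk : 1 ≤ k) :
    ConjugatesDynamics k (centerProj (jacobian F p₀)) (splitGraph φ) F
      (fun c => centerProj (jacobian F p₀) (F (c + φ c))) where
  contDiff := contDiff_of_linearMap _
  inverse := ⟨fun c => c + φ c, contDiff_graphMap h, fun c => ⟨c, rfl⟩,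
    fun c => centerProj_add_coe _ _ _, fun p hp => graphMap_centerProj hp⟩
  complete p hp := by
    obtain ⟨γ, hγ, hγ0, -⟩ := h.exists_orbit hp
    exact ⟨γ, hγ, hγ0, h.invariant γ hγ (hγ0 ▸ hp)⟩
  curves J γ _ hγ := by
    refine ⟨fun hc t ht => ?_, fun hc t ht => ?_⟩
    · have := (LinearMap.toContinuousLinearMap
        (centerProj (jacobian F p₀))).hasFDerivAt.comp_hasDerivWithinAt t (hc t ht)
      simp only [graphMap_centerProj (hγ t ht)]
      exact this
    -- Conversely, the graph map lifts the reduced curve back to `γ`, and tangency turns its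
    -- velocity into `F`.
    · have hs := ((contDiff_graphMap h).differentiable (by exact_mod_cast Nat.one_le_iff_ne_zero.1 hk)
        (centerProj (jacobian F p₀) (γ t))).hasFDerivAt
      have hcomp := hs.comp_hasDerivWithinAt t (hc t ht)
      rw [h.fderiv_graphMap hk, graphMap_centerProj (hγ t ht)] at hcomp
      exact hcomp.congr_of_mem (fun u hu => (graphMap_centerProj (hγ u hu)).symm) ht

end Conjugacy

/-! ### Compatibility with the feedforward structure -/

section Feedforward

variable {E₁ E₂ : Type*}
    [NormedAddCommGroup E₁] [NormedSpace ℝ E₁] [NormedAddCommGroup E₂] [NormedSpace ℝ E₂]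
    {k : ℕ} {f : E₁ → E₁} {g : E₁ × E₂ → E₂}

theorem fst_fderiv_feedforward (hf : Differentiable ℝ f) (hg : Differentiable ℝ g)
    (p v : E₁ × E₂) : (fderiv ℝ (feedforward f g) p v).1 = fderiv ℝ f p.1 v.1 := by
  have h := ((hf p.1).hasFDerivAt.comp p hasFDerivAt_fst).prodMk (hg p).hasFDerivAt
  have h' : HasFDerivAt (feedforward f g) _ p := h
  rw [h'.fderiv]
  rfl

variable [FiniteDimensional ℝ E₁] [FiniteDimensional ℝ E₂]

theorem fst_proj_feedforward (hf : Differentiable ℝ f) (hg : Differentiable ℝ g)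
    (p v : E₁ × E₂) :
    (centerProj (jacobian (feedforward f g) p) v : E₁ × E₂).1 =
        centerProj (jacobian f p.1) v.1 ∧
      (hyperbolicProj (jacobian (feedforward f g) p) v : E₁ × E₂).1 =
        hyperbolicProj (jacobian f p.1) v.1 :=
  map_proj _ _ (LinearMap.fst ℝ E₁ E₂) (fst_fderiv_feedforward hf hg p) v

/-- A point of the center manifold of a feedforward field lies over a complete orbit of the first
component with bounded hyperbolic part. -/
theorem exists_orbit_fst (hf : Differentiable ℝ f) (hg : Differentiable ℝ g) {p₀ : E₁ × E₂}
    {φ : centerSubspace (jacobian (feedforward f g) p₀) →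
      hyperbolicSubspace (jacobian (feedforward f g) p₀)}
    (h : IsGlobalCenterManifold k (feedforward f g) p₀ φ)
    (c : centerSubspace (jacobian (feedforward f g) p₀)) :
    ∃ x : ℝ → E₁, IsIntegralCurve x (fun _ => f) ∧
      x 0 = (c : E₁ × E₂).1 + (φ c : E₁ × E₂).1 ∧
      (∃ C : ℝ, ∀ t, ‖hyperbolicProj (jacobian f p₀.1) (x t)‖ ≤ C) ∧
      (centerProj (jacobian f p₀.1) (x 0) : E₁) = (c : E₁ × E₂).1 ∧
      (hyperbolicProj (jacobian f p₀.1) (x 0) : E₁) = (φ c : E₁ × E₂).1 := by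
  obtain ⟨γ, hγ, hγ0, C, hC⟩ := h.exists_orbit (p := (c : E₁ × E₂) + φ c) ⟨c, rfl⟩
  refine ⟨fun t => (γ t).1, fun t => ?_, by simp [hγ0], ⟨C, fun t => ?_⟩, ?_, ?_⟩
  · exact (hasFDerivAt_fst (𝕜 := ℝ) (p := γ t)).comp_hasDerivAt t (hγ t)
  · refine le_trans ?_ (hC t)
    have h1 := norm_fst_le (hyperbolicProj (jacobian (feedforward f g) p₀) (γ t) : E₁ × E₂)
    rwa [(fst_proj_feedforward hf hg p₀ (γ t)).2] at h1
  · rw [← (fst_proj_feedforward hf hg p₀ (γ 0)).1, hγ0, centerProj_add_coe]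
  · rw [← (fst_proj_feedforward hf hg p₀ (γ 0)).2, hγ0, hyperbolicProj_add_coe]

/-- If the first component of `φ` depends on the first component of its argument only, then the
vector field on the center subspace is of feedforward form. -/
theorem exists_feedforward_form (hk : 1 ≤ k) (hf : ContDiff ℝ k f) (hg : ContDiff ℝ k g)
    {x₀ : E₁} {y₀ : E₂}
    {φ : centerSubspace (jacobian (feedforward f g) (x₀, y₀)) →
      hyperbolicSubspace (jacobian (feedforward f g) (x₀, y₀))}
    (h : IsGlobalCenterManifold k (feedforward f g) (x₀, y₀) φ)
    (hφ : ∀ c c' : centerSubspace (jacobian (feedforward f g) (x₀, y₀)),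
      (c : E₁ × E₂).1 = (c' : E₁ × E₂).1 → (φ c : E₁ × E₂).1 = (φ c' : E₁ × E₂).1) :
    ∃ (fc : centerSubspace (jacobian f x₀) → centerSubspace (jacobian f x₀))
      (gc : centerSubspace (jacobian (feedforward f g) (x₀, y₀)) → E₂),
      ContDiff ℝ k fc ∧ ContDiff ℝ k gc ∧
      ∀ p : centerSubspace (jacobian (feedforward f g) (x₀, y₀)),
        ∃ hp : (p : E₁ × E₂).1 ∈ centerSubspace (jacobian f x₀),
          (centerProj (jacobian (feedforward f g) (x₀, y₀)) (feedforward f g (p + φ p)) : E₁ × E₂) =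
            ((fc ⟨(p : E₁ × E₂).1, hp⟩ : E₁), gc p) := by
  have hk0 : (k : WithTop ℕ∞) ≠ 0 := by exact_mod_cast Nat.one_le_iff_ne_zero.1 hk
  have hproj := fst_proj_feedforward (hf.differentiable hk0) (hg.differentiable hk0) (x₀, y₀)
  -- A linear section of the first-component map between center subspaces, a ↦ π^c (a, 0); it makes
  -- the reduced first component a `C^k` function of `a` alone.
  let lift : centerSubspace (jacobian f x₀) →ₗ[ℝ]
      centerSubspace (jacobian (feedforward f g) (x₀, y₀)) :=
    centerProj _ ∘ₗ LinearMap.inl ℝ E₁ E₂ ∘ₗ Submodule.subtype _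
  have hlift : ∀ a, (lift a : E₁ × E₂).1 = a := by
    intro a
    refine (hproj _).1.trans ?_
    exact congrArg _ (Submodule.projectionOnto_apply_left _ a)
  have hF : ContDiff ℝ k (feedforward f g) := (hf.comp contDiff_fst).prodMk hg
  refine ⟨fun a => centerProj (jacobian f x₀) (f (a + (φ (lift a) : E₁ × E₂).1)),
    fun p => (centerProj (jacobian (feedforward f g) (x₀, y₀))
      (feedforward f g (p + φ p)) : E₁ × E₂).2, ?_, ?_, fun p => ?_⟩
  · refine (contDiff_of_linearMap _).comp (hf.comp
      ((contDiff_of_linearMap (Submodule.subtype (centerSubspace (jacobian f x₀)))).add ?_))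
    exact (contDiff_of_linearMap (LinearMap.fst ℝ E₁ E₂ ∘ₗ Submodule.subtype _)).comp
      (h.contDiff.comp (contDiff_of_linearMap lift))
  · exact (contDiff_of_linearMap (LinearMap.snd ℝ E₁ E₂ ∘ₗ Submodule.subtype _ ∘ₗ centerProj _)).comp
      (hF.comp (contDiff_graphMap h))
  · have hp : (p : E₁ × E₂).1 ∈ centerSubspace (jacobian f x₀) := by
      have := (hproj p).1
      rw [centerProj, Submodule.projectionOnto_apply_left] at this
      rw [this]
      exact Subtype.property _
    refine ⟨hp, Prod.ext ?_ rfl⟩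
    rw [(hproj _).1]
    change _ = (centerProj (jacobian f x₀)
      (f ((p : E₁ × E₂).1 + (φ (lift ⟨_, hp⟩) : E₁ × E₂).1)) : E₁)
    rw [hφ (lift ⟨_, hp⟩) p (hlift _)]
    rfl

end Feedforward

/-! ### The main theorem -/

theorem lemma2p2 {E₁ E₂ : Type*}
    [NormedAddCommGroup E₁] [NormedSpace ℝ E₁] [FiniteDimensional ℝ E₁]
    [NormedAddCommGroup E₂] [NormedSpace ℝ E₂] [FiniteDimensional ℝ E₂]
    (k : ℕ) (hk : 1 ≤ k) (L : E₁ × E₂ →L[ℝ] E₁ × E₂) :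
    ∃ ε : ℝ, 0 < ε ∧
    ∀ (f : E₁ → E₁) (g : E₁ × E₂ → E₂), ContDiff ℝ k f → ContDiff ℝ k g →
    ∀ (x₀ : E₁) (y₀ : E₂), f x₀ = 0 → g (x₀, y₀) = 0 →
    fderiv ℝ (feedforward f g) (x₀, y₀) = L →
    ∀ φ : centerSubspace (jacobian (feedforward f g) (x₀, y₀)) →
      hyperbolicSubspace (jacobian (feedforward f g) (x₀, y₀)),
    IsGlobalCenterManifold k (feedforward f g) (x₀, y₀) φ →
    (AdmitsGlobalCenterManifold k f x₀ ∨ ∀ p, ‖fderiv ℝ (feedforward f g) p - L‖ ≤ ε) →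
    ∃ Fc : centerSubspace (jacobian (feedforward f g) (x₀, y₀)) →
        centerSubspace (jacobian (feedforward f g) (x₀, y₀)),
      ConjugatesDynamics k (centerProj (jacobian (feedforward f g) (x₀, y₀)))
        (splitGraph φ) (feedforward f g) Fc ∧
      ∃ (fc : centerSubspace (jacobian f x₀) → centerSubspace (jacobian f x₀))
        (gc : centerSubspace (jacobian (feedforward f g) (x₀, y₀)) → E₂),
        ContDiff ℝ k fc ∧ ContDiff ℝ k gc ∧
        ∀ p : centerSubspace (jacobian (feedforward f g) (x₀, y₀)),
          ∃ hp : (p : E₁ × E₂).1 ∈ centerSubspace (jacobian f x₀),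
            (Fc p : E₁ × E₂) = ((fc ⟨(p : E₁ × E₂).1, hp⟩ : E₁), gc p) := by
  -- The E₁-block of L equals Df(x₀) for every admissible field, so ε can be fixed before `f` and
  -- `g`.
  obtain ⟨ε, hε, huniq⟩ := exists_eq_zero_of_hyperbolicProj_bounded
    (ContinuousLinearMap.fst ℝ E₁ E₂ ∘L L ∘L ContinuousLinearMap.inl ℝ E₁ E₂)
  refine ⟨ε, hε, fun f g hf hg x₀ y₀ _ _ hL φ hφ hor => ⟨_, hφ.conjugatesDynamics hk,
    exists_feedforward_form hk hf hg hφ fun c c' hcc' => ?_⟩⟩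
  have hk0 : (k : WithTop ℕ∞) ≠ 0 := by exact_mod_cast Nat.one_le_iff_ne_zero.1 hk
  have hfd := hf.differentiable hk0
  have hgd := hg.differentiable hk0
  obtain ⟨x, hx, hx0, ⟨C, hC⟩, hxc, hxh⟩ := exists_orbit_fst hfd hgd hφ c
  obtain ⟨x', hx', hx0', ⟨C', hC'⟩, hxc', hxh'⟩ := exists_orbit_fst hfd hgd hφ c'
  have hcenter : centerProj (jacobian f x₀) (x 0) = centerProj (jacobian f x₀) (x' 0) :=
    Subtype.ext (by rw [hxc, hxc', hcc'])
  rw [← hxh, ← hxh']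
  rcases hor with ⟨ψ, hψ⟩ | hclose
  · have key : ∀ u : ℝ → E₁, IsIntegralCurve u (fun _ => f) →
        (∃ C : ℝ, ∀ t, ‖hyperbolicProj (jacobian f x₀) (u t)‖ ≤ C) →
        hyperbolicProj (jacobian f x₀) (u 0) = ψ (centerProj (jacobian f x₀) (u 0)) := by
      intro u hu hb
      have hmem : u 0 ∈ splitGraph ψ := by
        rw [hψ.eq_bounded]
        exact ⟨u, hu, rfl, hb⟩
      obtain ⟨a, ha⟩ := hmem
      simp only [← ha, centerProj_add_coe, hyperbolicProj_add_coe]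
    change ((hyperbolicProj (jacobian f x₀) (x 0) : hyperbolicSubspace (jacobian f x₀)) : E₁) =
      (hyperbolicProj (jacobian f x₀) (x' 0) : hyperbolicSubspace (jacobian f x₀))
    rw [key x hx ⟨C, hC⟩, key x' hx' ⟨C', hC'⟩, hcenter]
  · have hfst := fst_fderiv_feedforward hfd hgd
    have hA : ContinuousLinearMap.fst ℝ E₁ E₂ ∘L L ∘L ContinuousLinearMap.inl ℝ E₁ E₂ =
        fderiv ℝ f x₀ := by
      ext v
      rw [← hL]
      exact hfst (x₀, y₀) (v, 0)
    -- Since v ↦ (v, 0) is isometric and the first projection is norm-nonincreasing, the bound on DF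
    -- - L passes to this block.
    have hnear : ∀ a, ‖fderiv ℝ f a - fderiv ℝ f x₀‖ ≤ ε := by
      intro a
      refine ContinuousLinearMap.opNorm_le_bound _ hε.le fun v => ?_
      have h1 : (fderiv ℝ f a - fderiv ℝ f x₀) v =
          ((fderiv ℝ (feedforward f g) (a, 0) - L) (v, 0)).1 := by
        rw [← hL, sub_apply, sub_apply, Prod.fst_sub, hfst, hfst]
      rw [h1]
      refine (norm_fst_le _).trans ((ContinuousLinearMap.le_opNorm _ _).trans ?_)
      have h2 : ‖((v, 0) : E₁ × E₂)‖ = ‖v‖ := by simp [Prod.norm_def]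
      rw [h2]
      exact mul_le_mul_of_nonneg_right (hclose _) (norm_nonneg _)
    rw [hA] at huniq
    have hz := huniq (fun t => x t - x' t) (fun t => f (x t) - f (x' t))
      (fun t => (hx t).sub (hx' t)) (fun t => ?_)
      (by
        change centerProj (jacobian f x₀) (x 0 - x' 0) = 0
        rw [map_sub, hcenter, sub_self])
      ⟨C + C', fun t => by
        change ‖hyperbolicProj (jacobian f x₀) (x t - x' t)‖ ≤ C + C'
        rw [map_sub]
        exact (norm_sub_le _ _).trans (add_le_add (hC t) (hC' t))⟩
    · rw [sub_eq_zero.1 hz]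
    -- The mean value inequality for f - Df(x₀) bounds the perturbation by ε times the difference of
    -- the two orbits.
    · have hdiff : ∀ a, HasFDerivAt (fun a => f a - fderiv ℝ f x₀ a)
          (fderiv ℝ f a - fderiv ℝ f x₀) a := fun a =>
        (hfd a).hasFDerivAt.sub (fderiv ℝ f x₀).hasFDerivAt
      have h3 := convex_univ.norm_image_sub_le_of_norm_hasFDerivWithin_le
        (fun a _ => (hdiff a).hasFDerivWithinAt) (fun a _ => hnear a)
        (Set.mem_univ (x' t)) (Set.mem_univ (x t))
      convert h3 using 2
      rw [map_sub]
      abel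

end
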